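/- Let $S=\{(m,n)\in\mathbb N\times\mathbb N : m<n\}$ be partially ordered by $(m_1,n_1)<(m_2,n_2)$ if and only if $n_1<n_2$. Let $T_\forall$ be the theory, in the language $\{E_s\}_{s\in S}$ of binary relation symbols, stating that every $E_s$ is an equivalence relation and that $x\mathrel{E_s}y$ implies $x\mathrel{E_t}y$ whenever $s\le t$. Call linearly ordered sequences of tuples $(I_j)_{j\in J}$ mutually indiscernible if each $I_j$ is indiscernible over the set of all elements occurring in the sequences $I_k$, $k\neq j$. A complete type $p$ over $\emptyset$ has dp-rank $\le\mu$ (for a cardinal $\mu$) if for every realization $c$ of $p$ and every family of $1+\mu$ infinite mutually indiscernible sequences at least one of them is indiscernible over $c$; it has dp-rank $\mu$ if it has dp-rank $\le\mu$ but does not have dp-rank $\le\lambda$ for any $\lambda<\mu$. **Theorem.** $T_\forall$ has a model completion $T$. It is a complete $\aleph_0$-stable theory, and for every model $M$ of $T$ and every element $c\in M$: 1. for every $n\in\mathbb N$ there are in $M$ $n$ mutually indiscernible infinite sequences (over $\emptyset$), none of which is indiscernible over $c$; 2. there is no infinite family of mutually indiscernible infinite sequences in $M$ none of which is indiscernible over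 $c$. Consequently, the unique complete $1$-type of $T$ over $\emptyset$ has dp-rank $\omega=\aleph_0$, although no infinite family as in 2 exists. -/

import Mathlib

open FirstOrder FirstOrder.Language Cardinal

universe u v w

namespace DpRank

section General

variable {L : FirstOrder.Language.{u, v}}

/-- `Tstar` is a model completion of `T`: every model of `Tstar` is a model of `T`, and for every
model `M` of `T` the theory `Tstar ∪ Diag(M)` is consistent and complete. Models of
`Tstar ∪ Diag(M)` are presented as models `N` of `Tstar` with an embedding of `M` into `N`, and
sentences with constants naming the elements of `M` as formulas with variables in `M`. -/
structure IsModelCompletion (T Tstar : L.Theory) : Prop where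
  models : ∀ φ ∈ T, Tstar ⊨ᵇ φ
  consistent : ∀ (M : Type (max u v)) [L.Structure M] [Nonempty M], M ⊨ T →
    ∃ (N : Type (max u v)) (_ : L.Structure N), N ⊨ Tstar ∧ Nonempty (M ↪[L] N)
  complete : ∀ (M N₁ N₂ : Type (max u v)) [L.Structure M] [L.Structure N₁] [L.Structure N₂]
    [Nonempty M], M ⊨ T → N₁ ⊨ Tstar → N₂ ⊨ Tstar →
    ∀ (f₁ : M ↪[L] N₁) (f₂ : M ↪[L] N₂) (φ : L.Formula M), φ.Realize f₁ ↔ φ.Realize f₂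

/-- `ℵ₀`-stability: over every countable set of parameters `A` in a model there are only countably
many complete types in any finite number of variables. -/
def IsAleph0Stable (T : L.Theory) : Prop :=
  ∀ (M : Type (max u v w)) [L.Structure M] [Nonempty M], M ⊨ T →
    ∀ A : Set M, A.Countable → ∀ n : ℕ,
      Countable ((L[[A]].completeTheory M).CompleteType (Fin n))

/-- The sequence of `α`-tuples `(a i)_{i ∈ I}` of elements of `M` is indiscernible over `B`: any two
increasing finite subsequences of the same length satisfy the same formulas with parameters
from `B`. -/
def IndiscernibleOver (L : FirstOrder.Language.{u, v}) {M : Type*} [L.Structure M] (B : Set M)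
    {I : Type*} [LinearOrder I] {α : Type*} (a : I → α → M) : Prop :=
  ∀ (n : ℕ) (s t : Fin n ↪o I) (φ : L.Formula (B ⊕ (Fin n × α))),
    φ.Realize (Sum.elim (fun b : B => (b : M)) fun x => a (s x.1) x.2) ↔
      φ.Realize (Sum.elim (fun b : B => (b : M)) fun x => a (t x.1) x.2)

/-- The sequences `(a j i)_{i ∈ I j}`, `j ∈ J`, are mutually indiscernible over `B`: each of them is
indiscernible over `B` together with all elements of all the other sequences. -/
def MutuallyIndiscernibleOver (L : FirstOrder.Language.{u, v}) {M : Type*} [L.Structure M] (B : Set M)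
    {J : Type*} {I : J → Type*} [∀ j, LinearOrder (I j)] {α : J → Type*}
    (a : ∀ j, I j → α j → M) : Prop :=
  ∀ j, IndiscernibleOver L (B ∪ {m | ∃ k, k ≠ j ∧ ∃ i x, a k i x = m}) (a j)

/-- For a complete type `p` over `∅`, the dp-rank of `p` is at most `μ`: for every realization `c`
of `p` in a model of `T` and every family of `1 + μ` infinite mutually indiscernible sequences,
at least one of the sequences is indiscernible over `c`. -/
def DpRankLE {T : L.Theory} {β : Type} (p : T.CompleteType β) (μ : Cardinal.{w}) : Prop :=
  ∀ (M : Type (max u v w)) [L.Structure M] [Nonempty M] [M ⊨ T] (c : β → M), T.typeOf c = p →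
    ∀ (J : Type w) (I : J → Type w) [∀ j, LinearOrder (I j)] [∀ j, Infinite (I j)]
      (α : J → Type w) (a : ∀ j, I j → α j → M),
      #J = 1 + μ → MutuallyIndiscernibleOver L ∅ a →
        ∃ j, IndiscernibleOver L (Set.range c) (a j)

/-- The dp-rank of `p` equals `μ`. -/
def HasDpRank {T : L.Theory} {β : Type} (p : T.CompleteType β) (μ : Cardinal.{w}) : Prop :=
  DpRankLE p μ ∧ ∀ ν < μ, ¬ DpRankLE p ν

end General

/-- The index set of pairs `(m, n)` of natural numbers with `m < n`; `n` is the level. -/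
structure Idx where
  m : ℕ
  n : ℕ
  lt : m < n

/-- `s < t` if and only if the level of `s` is smaller than the level of `t`. -/
instance : PartialOrder Idx where
  le s t := s = t ∨ s.n < t.n
  lt s t := s.n < t.n
  le_refl _ := Or.inl rfl
  le_trans := by
    rintro a b c (rfl | h) (rfl | h')
    · exact Or.inl rfl
    · exact Or.inr h'
    · exact Or.inr h
    · exact Or.inr (h.trans h')
  le_antisymm := by
    rintro a b (rfl | h) (h' | h')
    · rfl
    · rfl
    · exact h'.symm
    · exact absurd h' h.asymm
  lt_iff_le_not_ge := by
    intro a b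
    constructor
    · intro h
      refine ⟨Or.inr h, ?_⟩
      rintro (rfl | h')
      · exact lt_irrefl _ h
      · exact h.asymm h'
    · rintro ⟨rfl | h, h'⟩
      · exact absurd (Or.inl rfl) h'
      · exact h

/-- One binary relation symbol `E_s` for every index `s`. -/
inductive NestedRel : ℕ → Type
  | E (s : Idx) : NestedRel 2

/-- The language with a binary relation symbol `E_s` for every index `s`. -/
def nestedLang : FirstOrder.Language.{0, 0} where
  Functions _ := Empty
  Relations := NestedRel

/-- The relation symbol `E_s`. -/
def relE (s : Idx) : nestedLang.Relations 2 := NestedRel.E s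

/-- The universal theory saying that every `E_s` is an equivalence relation and that `E_s` refines
`E_t` whenever `s ≤ t`. -/
def nestedTheory : nestedLang.Theory :=
  {φ | ∃ s : Idx, φ = (relE s).reflexive ∨ φ = (relE s).symmetric ∨ φ = (relE s).transitive} ∪
  {φ | ∃ s t : Idx, s ≤ t ∧
    φ = ∀' ∀' ((relE s).boundedFormula₂ (&0) &1 ⟹ (relE t).boundedFormula₂ (&0) &1)}

end DpRank

/-! Level `n` carries `n` incomparable relations, each contained in every relation of higher level.
The model completion is axiomatized by `HasExtension`: within a class of all relations above a
level, the relations of that level cross independently. A formula sees only finitely many levels, so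
a back-and-forth that loses one level per quantifier (`AgreeUpTo.exists_extension`, `exists_level`)
gives quantifier elimination, `Agree.realize_iff`. All symbols being binary, the rest is a matter of
pairs of elements: completeness is immediate, and stability follows by counting codes of atomic
types. If `c` breaks the indiscernibility of each of several mutually indiscernible sequences, each
sequence yields an index `s` at which `c` tells two of its entries apart. These indices form an
antichain, since a related entry of one sequence could otherwise replace `c` as a parameter for
another. Antichains lie within one level, so they are finite, but unbounded in size. Conversely, the
`n` relations of level `n` let `c` break `n` sequences at once (`exists_generic_array`). -/

namespace DpRank

/-! ### The relations `E_s` in a structure -/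

section Relations

variable {M : Type*} [nestedLang.Structure M]

/-- The interpretation of `E_s`. -/
def E (s : Idx) (x y : M) : Prop := Structure.RelMap (relE s) ![x, y]

/-- `x` and `y` are related by all `E_s` whose level is at least `l`. -/
def RelFrom (l : ℕ) (x y : M) : Prop := ∀ s : Idx, l ≤ s.n → E s x y

variable (M) in
/-- The structure satisfies the universal theory `nestedTheory`. -/
structure IsNested : Prop where
  refl : ∀ s (x : M), E s x x
  symm : ∀ s (x y : M), E s x y → E s y x
  trans : ∀ s (x y z : M), E s x y → E s y z → E s x z
  mono : ∀ s t (x y : M), s ≤ t → E s x y → E t x y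

theorem model_nestedTheory_iff : M ⊨ nestedTheory ↔ IsNested M := by
  have key : ∀ s t : Idx, M ⊨ (∀' ∀' ((relE s).boundedFormula₂ (&0) &1 ⟹
      (relE t).boundedFormula₂ (&0) &1) : nestedLang.Sentence) ↔
      ∀ x y : M, E s x y → E t x y := fun s t =>
    forall₂_congr fun _ _ =>
      imp_congr BoundedFormula.realize_rel₂ BoundedFormula.realize_rel₂
  constructor
  · intro h
    have hE : ∀ φ ∈ nestedTheory, M ⊨ φ := fun φ hφ => h.realize_of_mem φ hφ
    refine ⟨fun s => ?_, fun s => ?_, fun s => ?_, fun s t x y hst => ?_⟩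
    · exact (Relations.realize_reflexive.1 (hE _ (Or.inl ⟨s, Or.inl rfl⟩))).refl
    · exact (Relations.realize_symmetric.1 (hE _ (Or.inl ⟨s, Or.inr (Or.inl rfl)⟩))).symm
    · exact (Relations.realize_transitive.1 (hE _ (Or.inl ⟨s, Or.inr (Or.inr rfl)⟩))).trans
    · exact (key s t).1 (hE _ (Or.inr ⟨s, t, hst, rfl⟩)) x y
  · intro h
    refine ⟨fun φ hφ => ?_⟩
    rcases hφ with ⟨s, rfl | rfl | rfl⟩ | ⟨s, t, hst, rfl⟩
    · exact Relations.realize_reflexive.2 ⟨h.refl s⟩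
    · exact Relations.realize_symmetric.2 ⟨h.symm s⟩
    · exact Relations.realize_transitive.2 ⟨h.trans s⟩
    · exact (key s t).2 fun x y => h.mono s t x y hst

namespace IsNested

variable (hM : IsNested M)
include hM

theorem congr_right {s : Idx} {x y z : M} (h : E s y z) : E s x y ↔ E s x z :=
  ⟨fun h' => hM.trans _ _ _ _ h' h, fun h' => hM.trans _ _ _ _ h' (hM.symm _ _ _ h)⟩

theorem congr_left {s : Idx} {x y z : M} (h : E s x y) : E s x z ↔ E s y z :=
  ⟨fun h' => hM.trans _ _ _ _ (hM.symm _ _ _ h) h', fun h' => hM.trans _ _ _ _ h h'⟩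

theorem comm {s : Idx} {x y : M} : E s x y ↔ E s y x := ⟨hM.symm _ _ _, hM.symm _ _ _⟩

theorem relFrom_refl (l : ℕ) (x : M) : RelFrom l x x := fun s _ => hM.refl s x

theorem relFrom_symm {l : ℕ} {x y : M} (h : RelFrom l x y) : RelFrom l y x :=
  fun s hs => hM.symm _ _ _ (h s hs)

theorem relFrom_trans {l : ℕ} {x y z : M} (h : RelFrom l x y) (h' : RelFrom l y z) :
    RelFrom l x z := fun s hs => hM.trans _ _ _ _ (h s hs) (h' s hs)

theorem relFrom_of_rel {s : Idx} {x y : M} (h : E s x y) : RelFrom (s.n + 1) x y :=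
  fun t ht => hM.mono s t x y (Or.inr ht) h

/-- Any one relation of level `l + 1` forces all higher ones, so `RelFrom` becomes a finite
condition. The level is a successor because level `0` has no relations and the hypothesis would be
vacuous there. -/
theorem relFrom_of_forall {l : ℕ} {x y : M} (h : ∀ m (hm : m < l + 1), E ⟨m, l + 1, hm⟩ x y) :
    RelFrom (l + 1) x y := by
  rintro ⟨m, n, hmn⟩ (hs : l + 1 ≤ n)
  rcases hs.eq_or_lt with rfl | hs
  · exact h m hmn
  · exact hM.mono ⟨0, l + 1, l.succ_pos⟩ _ _ _ (Or.inr hs) (h 0 _)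

end IsNested

variable (M) in
/-- The extension property: if the `g i` are related by all relations of level greater than
`n + 1`, then their classes for the relations of level `n + 1` have a common element, which
moreover can be chosen unrelated to given finitely many elements in all levels up to `n`. -/
def HasExtension : Prop :=
  ∀ (n k : ℕ) (g : Fin (n + 1) → M) (b : Fin k → M),
    (∀ i j, RelFrom (n + 2) (g i) (g j)) →
    ∃ x, (∀ i : Fin (n + 1), E ⟨i, n + 1, i.2⟩ x (g i)) ∧
      ∀ j, x ≠ b j ∧ ∀ s : Idx, s.n ≤ n → ¬ E s x (b j)

theorem HasExtension.exists_of_finite (h : HasExtension M) {ι : Type*} [Finite ι] (n : ℕ)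
    (g : Fin (n + 1) → M) (b : ι → M) (hg : ∀ i j, RelFrom (n + 2) (g i) (g j)) :
    ∃ x, (∀ i : Fin (n + 1), E ⟨i, n + 1, i.2⟩ x (g i)) ∧
      ∀ j, x ≠ b j ∧ ∀ s : Idx, s.n ≤ n → ¬ E s x (b j) := by
  obtain ⟨k, ⟨e⟩⟩ := Finite.exists_equiv_fin ι
  obtain ⟨x, hx, hx'⟩ := h n k g (b ∘ e.symm) hg
  exact ⟨x, hx, fun j => by simpa using hx' (e j)⟩

end Relations

/-! ### Axioms for the extension property -/

section Axioms

/-- The hypothesis of the extension property as a formula. -/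
noncomputable def extHyp (n k : ℕ) : nestedLang.Formula (Fin (n + 1) ⊕ Fin k) :=
  Formula.iInf fun p : Fin (n + 1) × Fin (n + 1) × Fin (n + 2) =>
    (relE ⟨p.2.2, n + 2, p.2.2.2⟩).formula₂ (Term.var (Sum.inl p.1)) (Term.var (Sum.inl p.2.1))

/-- The conclusion of the extension property as a formula. -/
noncomputable def extConcl (n k : ℕ) : nestedLang.Formula (Fin (n + 1) ⊕ Fin k) :=
  Formula.iExs Unit
    ((Formula.iInf fun i : Fin (n + 1) =>
        (relE ⟨i, n + 1, i.2⟩).formula₂ (Term.var (Sum.inr ())) (Term.var (Sum.inl (Sum.inl i)))) ⊓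
      ((Formula.iInf fun j : Fin k =>
          ∼ (Term.equal (Term.var (Sum.inr ())) (Term.var (Sum.inl (Sum.inr j))))) ⊓
        Formula.iInf fun p : Fin k × Fin n =>
          ∼ ((relE ⟨p.2, n, p.2.2⟩).formula₂ (Term.var (Sum.inr ()))
            (Term.var (Sum.inl (Sum.inr p.1))))))

/-- The extension axiom. -/
noncomputable def extAxiom (n k : ℕ) : nestedLang.Sentence :=
  Formula.iAlls (Fin (n + 1) ⊕ Fin k)
    (((extHyp n k).imp (extConcl n k)).relabel Sum.inr)

variable {M : Type*} [nestedLang.Structure M]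

theorem realize_extHyp (hM : IsNested M) {n k : ℕ} {v : Fin (n + 1) ⊕ Fin k → M} :
    (extHyp n k).Realize v ↔
      ∀ i j, RelFrom (n + 2) (v (Sum.inl i)) (v (Sum.inl j)) := by
  simp only [extHyp, Formula.realize_iInf, Formula.realize_rel₂, Prod.forall, Term.realize_var]
  refine forall₂_congr fun i j => ⟨fun h => ?_, fun h m => ?_⟩
  · exact hM.relFrom_of_forall fun m hm => h ⟨m, hm⟩
  · exact h ⟨m, n + 2, m.2⟩ le_rfl

/-- The formula excludes only relations of level exactly `n`: a relation of lower level would imply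
them. For `n = 0` nothing but the inequalities remains. -/
theorem realize_extConcl (hM : IsNested M) {n k : ℕ} {v : Fin (n + 1) ⊕ Fin k → M} :
    (extConcl n k).Realize v ↔
      ∃ x, (∀ i : Fin (n + 1), E ⟨i, n + 1, i.2⟩ x (v (Sum.inl i))) ∧
        ∀ j, x ≠ v (Sum.inr j) ∧ ∀ s : Idx, s.n ≤ n → ¬ E s x (v (Sum.inr j)) := by
  simp only [extConcl, Formula.realize_iExs, Formula.realize_inf, Formula.realize_iInf,
    Formula.realize_not, Formula.realize_rel₂, Formula.realize_equal, Term.realize_var,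
    Sum.elim_inl, Sum.elim_inr, Prod.forall]
  constructor
  · rintro ⟨i, h₁, h₂, h₃⟩
    refine ⟨i (), h₁, fun j => ⟨h₂ j, ?_⟩⟩
    rintro ⟨m, l, hml⟩ (hl : l ≤ n) hE
    rcases hl.eq_or_lt with rfl | hl
    · exact h₃ j ⟨m, hml⟩ hE
    · exact h₃ j ⟨m, hml.trans hl⟩ (hM.mono _ ⟨m, n, hml.trans hl⟩ _ _ (Or.inr hl) hE)
  · rintro ⟨x, h₁, h₂⟩
    exact ⟨fun _ => x, h₁, fun j => (h₂ j).1, fun j m => (h₂ j).2 ⟨m, n, m.2⟩ le_rfl⟩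

theorem realize_extAxiom {n k : ℕ} :
    M ⊨ extAxiom n k ↔ ∀ v : Fin (n + 1) ⊕ Fin k → M,
      (extHyp n k).Realize v → (extConcl n k).Realize v := by
  simp only [Sentence.Realize, extAxiom, Formula.realize_iAlls, Formula.realize_relabel,
    Formula.realize_imp]
  rfl

theorem hasExtension_iff (hM : IsNested M) : HasExtension M ↔ ∀ n k, M ⊨ extAxiom n k := by
  refine forall₂_congr fun n k => ?_
  simp only [realize_extAxiom, realize_extHyp hM, realize_extConcl hM]
  exact ⟨fun h v hv => h _ _ hv, fun h g b hg => h (Sum.elim g b) hg⟩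

/-- The axiomatization of the model completion of `nestedTheory`. -/
noncomputable def genericTheory : nestedLang.Theory :=
  nestedTheory ∪ {φ | ∃ n k, φ = extAxiom n k}

theorem model_genericTheory_iff : M ⊨ genericTheory ↔ IsNested M ∧ HasExtension M := by
  rw [genericTheory, Theory.model_union_iff, model_nestedTheory_iff]
  refine and_congr_right fun hM => ?_
  rw [hasExtension_iff hM, Theory.model_iff]
  exact ⟨fun h n k => h _ ⟨n, k, rfl⟩, by rintro h _ ⟨n, k, rfl⟩; exact h n k⟩

end Axioms

/-! ### The generic structure of coordinate functions -/

section Generic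

/-- Points given by one coordinate for every index `s` and one further coordinate. -/
def Coord (K : Type u) : Type u := Option Idx → K

variable {K : Type u}

/-- Two points are `E_s`-related if their coordinates agree at `s` and at all higher levels. -/
instance : nestedLang.Structure (Coord K) where
  funMap := fun f => f.elim
  RelMap := fun r => match r with
    | NestedRel.E s => fun x => ∀ t : Idx, s ≤ t → x 0 (some t) = x 1 (some t)

theorem Coord.E_iff {s : Idx} {x y : Coord K} :
    E s x y ↔ ∀ t : Idx, s ≤ t → x (some t) = y (some t) := Iff.rfl

theorem Coord.isNested : IsNested (Coord K) where
  refl _ _ _ _ := rfl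
  symm _ _ _ h t ht := (h t ht).symm
  trans _ _ _ _ h h' t ht := (h t ht).trans (h' t ht)
  mono _ _ _ _ hst h r hr := h r (hst.trans hr)

theorem Coord.hasExtension [Infinite K] : HasExtension (Coord K) := by
  intro n k g b hg
  have fresh : ∀ o : Option Idx, ∃ a : K, ∀ j, a ≠ b j o := fun o => by
    obtain ⟨a, ha⟩ := (Set.finite_range fun j => b j o).infinite_compl.nonempty
    exact ⟨a, fun j h => ha ⟨j, h.symm⟩⟩
  choose f hf using fresh
  -- Level `n + 1` copies the coordinate of the matching `g m`, higher levels copy `g 0` (all `g i`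
  -- agree there), and lower levels are fresh. The fresh coordinate at `none` makes `x` differ from
  -- every `b j`.
  let x : Coord K := fun o => match o with
    | none => f none
    | some t => if h : t.n = n + 1 then g ⟨t.m, h ▸ t.lt⟩ (some t)
      else if n + 1 < t.n then g 0 (some t) else f (some t)
  refine ⟨x, fun i => Coord.E_iff.2 fun t ht => ?_, fun j => ⟨fun h => ?_, fun s hs h => ?_⟩⟩
  · rcases ht with rfl | ht
    · simp [x]
    · have h₁ : n + 1 < t.n := ht
      have h₂ : ¬ t.n = n + 1 := h₁.ne'
      simp only [x, h₁, h₂, dif_neg, if_true, not_false_eq_true]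
      exact hg 0 i t h₁ t le_rfl
  · exact hf none j (congrFun h none)
  · have h₁ : ¬ n + 1 < s.n := by omega
    have h₂ : ¬ s.n = n + 1 := by omega
    have : x (some s) = b j (some s) := h s le_rfl
    simp only [x, h₁, h₂, dif_neg, if_false, not_false_eq_true] at this
    exact hf _ j this

/-- Each point is sent to the family of its classes, with its singleton at `none` for injectivity.
The summand `ℕ` keeps the coordinate set infinite when `M` is finite. -/
theorem Coord.exists_embedding {M : Type u} [nestedLang.Structure M] (hM : IsNested M) :
    Nonempty (M ↪[nestedLang] Coord (Set M ⊕ ℕ)) := by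
  refine ⟨{ toFun := fun x o => Sum.inl (match o with
              | none => {x}
              | some s => {y | E s x y})
            inj' := fun x y h => ?_
            map_fun' := fun f => f.elim
            map_rel' := ?_ }⟩
  · simpa using congrFun h none
  · rintro _ ⟨s⟩ x
    have hx : x = ![x 0, x 1] := by ext i; fin_cases i <;> rfl
    have key : ∀ t, ({y | E t (x 0) y} : Set M) = {y | E t (x 1) y} ↔ E t (x 0) (x 1) := by
      intro t
      constructor
      · intro h
        exact (Set.ext_iff.1 h (x 1)).2 (hM.refl _ _)
      · intro h
        ext y
        exact hM.congr_left h
    constructor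
    · intro h
      have h' : E s (x 0) (x 1) := (key s).1 (Sum.inl_injective (h s le_rfl))
      rw [hx]
      exact h'
    · intro h t ht
      rw [hx] at h
      exact congrArg Sum.inl ((key t).2 (hM.mono s t _ _ ht h))

end Generic

/-! ### Quantifier elimination -/

section QuantifierElimination

variable {M₁ : Type*} {M₂ : Type*} [nestedLang.Structure M₁] [nestedLang.Structure M₂]
  {ι : Type*}

/-- Two tuples satisfy the same equations and relations of level at most `N`. -/
def AgreeUpTo (N : ℕ) (u : ι → M₁) (w : ι → M₂) : Prop :=
  ∀ i j, (u i = u j ↔ w i = w j) ∧ ∀ s : Idx, s.n ≤ N → (E s (u i) (u j) ↔ E s (w i) (w j))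

/-- Two tuples satisfy the same atomic formulas. -/
def Agree (u : ι → M₁) (w : ι → M₂) : Prop :=
  ∀ i j, (u i = u j ↔ w i = w j) ∧ ∀ s, E s (u i) (u j) ↔ E s (w i) (w j)

theorem AgreeUpTo.symm {N : ℕ} {u : ι → M₁} {w : ι → M₂} (h : AgreeUpTo N u w) :
    AgreeUpTo N w u :=
  fun i j => ⟨(h i j).1.symm, fun s hs => ((h i j).2 s hs).symm⟩

theorem AgreeUpTo.mono {N N' : ℕ} (hN : N ≤ N') {u : ι → M₁} {w : ι → M₂}
    (h : AgreeUpTo N' u w) : AgreeUpTo N u w :=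
  fun i j => ⟨(h i j).1, fun s hs => (h i j).2 s (hs.trans hN)⟩

/-- Let `k + 1` be the least level at which `x` is related to some `u i`. Above it, `x` behaves like
`u i`; at it, the classes of `x` are prescribed one by one; below it, `x` is unrelated to the tuple.
The extra level of agreement is spent on showing that the prescribed classes lie in one class for
the relations of level `k + 2`. -/
theorem AgreeUpTo.exists_extension [Finite ι] [Nonempty M₂] (h₁ : IsNested M₁) (h₂ : IsNested M₂)
    (hext : HasExtension M₂) {N : ℕ} {u : ι → M₁} {w : ι → M₂} (h : AgreeUpTo (N + 1) u w)
    (x : M₁) :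
    ∃ y : M₂, ∀ i, (x = u i ↔ y = w i) ∧
      ∀ s : Idx, s.n ≤ N → (E s x (u i) ↔ E s y (w i)) := by
  classical
  by_cases hx : ∃ i, x = u i
  · obtain ⟨i, rfl⟩ := hx
    exact ⟨w i, fun j => ⟨(h i j).1, fun s hs => (h i j).2 s (hs.trans N.le_succ)⟩⟩
  simp only [not_exists] at hx
  by_cases hP : ∃ l, ∃ (s : Idx) (i : ι), s.n = l ∧ s.n ≤ N ∧ E s x (u i)
  · have hmin : ∀ (s : Idx) (i : ι), s.n ≤ N → s.n < Nat.find hP → ¬ E s x (u i) :=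
      fun s i hsN hs hE => Nat.find_min hP hs ⟨s, i, rfl, hsN, hE⟩
    obtain ⟨s₀, i₀, hs₀, hs₀N, hE₀⟩ := Nat.find_spec hP
    obtain ⟨k, hk⟩ : ∃ k, Nat.find hP = k + 1 :=
      Nat.exists_eq_succ_of_ne_zero (by have := s₀.lt; omega)
    rw [hk] at hs₀ hmin
    -- `y₀` supplies new classes of level `k + 1`, for those relations under which the class of `x`
    -- contains no `u i`.
    obtain ⟨y₀, hy₀, hy₀'⟩ := hext.exists_of_finite (k + 1) (fun _ => w i₀) w
      fun _ _ => h₂.relFrom_refl _ _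
    have hy₀F : RelFrom (k + 2) y₀ (w i₀) :=
      h₂.relFrom_of_forall fun m hm => hy₀ ⟨m, hm⟩
    let g : Fin (k + 1) → M₂ := fun m =>
      if hm : ∃ i, E ⟨m, k + 1, m.2⟩ x (u i) then w hm.choose else y₀
    have hxF : RelFrom (k + 2) x (u i₀) := by
      have := h₁.relFrom_of_rel hE₀
      rwa [hs₀] at this
    have hgF : ∀ m, RelFrom (k + 2) (g m) (w i₀) := by
      intro m
      by_cases hm : ∃ i, E ⟨m, k + 1, m.2⟩ x (u i)
      · simp only [g, dif_pos hm]
        have hu : RelFrom (k + 2) (u hm.choose) (u i₀) :=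
          h₁.relFrom_trans (h₁.relFrom_symm (h₁.relFrom_of_rel hm.choose_spec)) hxF
        refine h₂.relFrom_of_forall fun m' hm' => ?_
        exact ((h _ _).2 ⟨m', k + 1 + 1, hm'⟩ (show k + 1 + 1 ≤ N + 1 by omega)).1
          (hu _ le_rfl)
      · simpa only [g, dif_neg hm] using hy₀F
    obtain ⟨y, hy, hy'⟩ := hext.exists_of_finite k g w
      fun i j => h₂.relFrom_trans (hgF i) (h₂.relFrom_symm (hgF j))
    refine ⟨y, fun i => ⟨iff_of_false (hx i) (hy' i).1, fun s hs => ?_⟩⟩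
    rcases lt_trichotomy s.n (k + 1) with hsk | hsk | hsk
    · exact iff_of_false (hmin s i hs hsk) ((hy' i).2 s (Nat.lt_succ_iff.1 hsk))
    · obtain ⟨m, l, hml⟩ := s
      obtain rfl : l = k + 1 := hsk
      have hym := hy ⟨m, hml⟩
      rw [h₂.congr_left hym]
      by_cases hm : ∃ i, E ⟨m, k + 1, hml⟩ x (u i)
      · simp only [g, dif_pos hm]
        rw [h₁.congr_left hm.choose_spec]
        exact (h _ _).2 _ (hs.trans N.le_succ)
      · simp only [g, dif_neg hm]
        exact iff_of_false (fun h' => hm ⟨i, h'⟩) ((hy₀' i).2 _ le_rfl)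
    · have hyF : RelFrom (k + 2) y (w i₀) :=
        h₂.relFrom_trans (h₂.relFrom_of_rel (hy 0)) (hgF 0)
      rw [h₁.congr_left (hxF s hsk), h₂.congr_left (hyF s hsk)]
      exact (h _ _).2 s (hs.trans N.le_succ)
  · obtain ⟨w₀⟩ := ‹Nonempty M₂›
    obtain ⟨y, -, hy⟩ := hext.exists_of_finite N (fun _ => w₀) w fun _ _ => h₂.relFrom_refl _ _
    refine ⟨y, fun i => ⟨iff_of_false (hx i) (hy i).1, fun s hs => ?_⟩⟩
    exact iff_of_false (fun hE => hP ⟨_, s, i, rfl, hs, hE⟩) ((hy i).2 s hs)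

theorem AgreeUpTo.snoc (h₁ : IsNested M₁) (h₂ : IsNested M₂) {N n : ℕ} {u : ι → M₁}
    {w : ι → M₂} {xs : Fin n → M₁} {ys : Fin n → M₂}
    (h : AgreeUpTo N (Sum.elim u xs) (Sum.elim w ys)) {x : M₁} {y : M₂}
    (hxy : ∀ i, (x = Sum.elim u xs i ↔ y = Sum.elim w ys i) ∧
      ∀ s : Idx, s.n ≤ N → (E s x (Sum.elim u xs i) ↔ E s y (Sum.elim w ys i))) :
    AgreeUpTo N (Sum.elim u (Fin.snoc xs x : Fin (n + 1) → M₁))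
      (Sum.elim w (Fin.snoc ys y : Fin (n + 1) → M₂)) := by
  have cases : ∀ i : ι ⊕ Fin (n + 1),
      (∃ i' : ι ⊕ Fin n, Sum.elim u (Fin.snoc xs x : Fin (n + 1) → M₁) i = Sum.elim u xs i' ∧
        Sum.elim w (Fin.snoc ys y : Fin (n + 1) → M₂) i = Sum.elim w ys i') ∨
      (Sum.elim u (Fin.snoc xs x : Fin (n + 1) → M₁) i = x ∧
        Sum.elim w (Fin.snoc ys y : Fin (n + 1) → M₂) i = y) := by
    rintro (i | i)
    · exact Or.inl ⟨Sum.inl i, rfl, rfl⟩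
    · refine Fin.lastCases (Or.inr ?_) (fun i => Or.inl ⟨Sum.inr i, ?_⟩) i <;> simp
  intro i j
  rcases cases i with ⟨i', hi, hi'⟩ | ⟨hi, hi'⟩ <;> rcases cases j with ⟨j', hj, hj'⟩ | ⟨hj, hj'⟩ <;>
    rw [hi, hi', hj, hj']
  · exact h i' j'
  · rw [eq_comm, eq_comm (b := y)]
    refine ⟨(hxy i').1, fun s hs => ?_⟩
    rw [h₁.comm, h₂.comm]
    exact (hxy i').2 s hs
  · exact hxy j'
  · exact ⟨iff_of_true rfl rfl, fun s _ => iff_of_true (h₁.refl _ _) (h₂.refl _ _)⟩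

theorem term_eq_var {α : Type*} (t : nestedLang.Term α) : ∃ a, t = Term.var a := by
  cases t with
  | var a => exact ⟨a, rfl⟩
  | func f _ => exact f.elim

/-- The level depends on the formula alone, not on the tuples; this is why no saturation is needed.
-/
theorem exists_level [Finite ι] [Nonempty M₁] [Nonempty M₂] (h₁ : IsNested M₁)
    (hext₁ : HasExtension M₁) (h₂ : IsNested M₂) (hext₂ : HasExtension M₂) {n : ℕ}
    (φ : nestedLang.BoundedFormula ι n) :
    ∃ N, ∀ (u : ι → M₁) (w : ι → M₂) (xs : Fin n → M₁) (ys : Fin n → M₂),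
      AgreeUpTo N (Sum.elim u xs) (Sum.elim w ys) → (φ.Realize u xs ↔ φ.Realize w ys) := by
  induction φ with
  | falsum => exact ⟨0, fun _ _ _ _ _ => Iff.rfl⟩
  | equal t₁ t₂ =>
    obtain ⟨a, rfl⟩ := term_eq_var t₁
    obtain ⟨b, rfl⟩ := term_eq_var t₂
    exact ⟨0, fun u w xs ys h => (h a b).1⟩
  | rel R ts =>
    obtain ⟨s⟩ := R
    obtain ⟨a, ha⟩ := term_eq_var (ts 0)
    obtain ⟨b, hb⟩ := term_eq_var (ts 1)
    obtain rfl : ts = ![Term.var a, Term.var b] := by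
      ext i; fin_cases i <;> simp [ha, hb]
    refine ⟨s.n, fun u w xs ys h => ?_⟩
    have := (h a b).2 s le_rfl
    have e : BoundedFormula.rel (NestedRel.E s) ![Term.var a, Term.var b] =
      (relE s).boundedFormula₂ (Term.var a) (Term.var b) := rfl
    rwa [e, BoundedFormula.realize_rel₂, BoundedFormula.realize_rel₂]
  | imp φ ψ ihφ ihψ =>
    obtain ⟨N, hN⟩ := ihφ
    obtain ⟨N', hN'⟩ := ihψ
    refine ⟨max N N', fun u w xs ys h => ?_⟩
    exact imp_congr (hN u w xs ys (h.mono (le_max_left _ _)))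
      (hN' u w xs ys (h.mono (le_max_right _ _)))
  | all φ ih =>
    obtain ⟨N, hN⟩ := ih
    refine ⟨N + 1, fun u w xs ys h => ⟨fun hφ y => ?_, fun hφ x => ?_⟩⟩
    · obtain ⟨x, hx⟩ := h.symm.exists_extension h₂ h₁ hext₁ y
      exact (hN _ _ _ _ ((h.mono N.le_succ).snoc h₁ h₂
        fun i => ⟨(hx i).1.symm, fun s hs => ((hx i).2 s hs).symm⟩)).1 (hφ x)
    · obtain ⟨y, hy⟩ := h.exists_extension h₁ h₂ hext₂ x
      exact (hN _ _ _ _ ((h.mono N.le_succ).snoc h₁ h₂ hy)).2 (hφ y)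

/-- Quantifier elimination: tuples satisfying the same atomic formulas in nested structures with
the extension property satisfy the same formulas. -/
theorem Agree.realize_iff [Nonempty M₁] [Nonempty M₂] (h₁ : IsNested M₁)
    (hext₁ : HasExtension M₁) (h₂ : IsNested M₂) (hext₂ : HasExtension M₂)
    {u : ι → M₁} {w : ι → M₂} (h : Agree u w) (φ : nestedLang.Formula ι) :
    φ.Realize u ↔ φ.Realize w := by
  classical
  -- `exists_level` needs a finite index type, so only the free variables of `φ` are kept.
  have key₁ := BoundedFormula.realize_restrictFreeVar' (φ := φ) (s := φ.freeVarFinset)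
    subset_rfl (v := u) (xs := default)
  have key₂ := BoundedFormula.realize_restrictFreeVar' (φ := φ) (s := φ.freeVarFinset)
    subset_rfl (v := w) (xs := default)
  obtain ⟨N, hN⟩ := exists_level h₁ hext₁ h₂ hext₂
    (φ.restrictFreeVar (Set.inclusion (subset_rfl : (φ.freeVarFinset : Set ι) ⊆ _)))
  refine key₁.symm.trans ((hN _ _ _ _ ?_).trans key₂)
  rintro (i | i) (j | j)
  · exact ⟨(h i j).1, fun s _ => (h i j).2 s⟩
  all_goals first | exact i.elim0 | exact j.elim0

theorem agree_of_realize_iff {u : ι → M₁} {w : ι → M₂}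
    (h : ∀ φ : nestedLang.Formula ι, φ.Realize u ↔ φ.Realize w) : Agree u w := by
  intro i j
  refine ⟨?_, fun s => ?_⟩
  · simpa using h (Term.equal (Term.var i) (Term.var j))
  · exact Formula.realize_rel₂.symm.trans
      ((h ((relE s).formula₂ (Term.var i) (Term.var j))).trans Formula.realize_rel₂)

theorem embedding_E_iff (f : M₁ ↪[nestedLang] M₂) {s : Idx} {x y : M₁} :
    E s (f x) (f y) ↔ E s x y := by
  have : f ∘ ![x, y] = ![f x, f y] := by ext i; fin_cases i <;> rfl
  exact (this ▸ f.map_rel (relE s) ![x, y] :)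

end QuantifierElimination

/-! ### The model completion -/

section ModelCompletion

theorem isModelCompletion_genericTheory : IsModelCompletion nestedTheory genericTheory where
  models φ hφ := Theory.models_sentence_of_mem (Or.inl hφ)
  consistent M _ _ hM :=
    ⟨Coord (Set M ⊕ ℕ), inferInstance,
      model_genericTheory_iff.2 ⟨Coord.isNested, Coord.hasExtension⟩,
      Coord.exists_embedding (model_nestedTheory_iff.1 hM)⟩
  complete M N₁ N₂ _ _ _ _ hM h₁ h₂ f₁ f₂ φ := by
    rw [model_genericTheory_iff] at h₁ h₂
    have : Nonempty N₁ := .map f₁ inferInstance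
    have : Nonempty N₂ := .map f₂ inferInstance
    refine Agree.realize_iff h₁.1 h₁.2 h₂.1 h₂.2 (fun i j => ⟨?_, fun s => ?_⟩) φ
    · rw [f₁.injective.eq_iff, f₂.injective.eq_iff]
    · rw [embedding_E_iff, embedding_E_iff]

variable {T : nestedLang.Theory} (hT : IsModelCompletion nestedTheory T)
include hT

/-- A model `M` of `T` embeds in a generic structure, which embeds in a further model `N` of `T`.
The witness found in between is visible in `N`, and completeness of `T` over the diagram of `M`
brings its existence back to `M`. -/
theorem IsModelCompletion.models_extAxiom (n k : ℕ) : T ⊨ᵇ extAxiom n k := by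
  rw [Theory.models_sentence_iff]
  intro M
  have hM : M ⊨ nestedTheory := by
    refine ⟨fun φ hφ => (hT.models φ hφ).realize_sentence M⟩
  have hM' := model_nestedTheory_iff.1 hM
  obtain ⟨f⟩ := Coord.exists_embedding hM'
  have : Nonempty (Coord (Set M ⊕ ℕ)) := .map f inferInstance
  obtain ⟨N, _, hN, ⟨g⟩⟩ := hT.consistent _ (model_nestedTheory_iff.2
    (Coord.isNested (K := Set M ⊕ ℕ)))
  have : Nonempty N := .map g inferInstance
  have hN' : IsNested N := model_nestedTheory_iff.1
    ⟨fun φ hφ => (hT.models φ hφ).realize_sentence N⟩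
  rw [realize_extAxiom]
  intro v hv
  have key := hT.complete M M N hM M.is_model hN (.refl _ _) (g.comp f)
    ((extConcl n k).relabel v)
  rw [Formula.realize_relabel, Formula.realize_relabel] at key
  refine key.2 ?_
  rw [realize_extHyp hM'] at hv
  obtain ⟨x, hx, hx'⟩ := Coord.hasExtension (K := Set M ⊕ ℕ) n k
    (fun i => f (v (Sum.inl i))) (fun j => f (v (Sum.inr j)))
    fun i j s hs => (embedding_E_iff f).2 (hv i j s hs)
  refine (realize_extConcl hN').2 ⟨g x, fun i => ?_, fun j => ⟨fun h => ?_, fun s hs h => ?_⟩⟩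
  · exact (embedding_E_iff g).2 (hx i)
  · exact (hx' j).1 (g.injective h)
  · exact (hx' j).2 s hs ((embedding_E_iff g).1 h)

theorem IsModelCompletion.isNested {M : Type*} [nestedLang.Structure M] [Nonempty M]
    (hM : M ⊨ T) : IsNested M :=
  model_nestedTheory_iff.1 ⟨fun φ hφ => (hT.models φ hφ).realize_sentence M⟩

theorem IsModelCompletion.hasExtension {M : Type*} [nestedLang.Structure M] [Nonempty M]
    (hM : M ⊨ T) : HasExtension M :=
  (hasExtension_iff (hT.isNested hM)).2 fun n k =>
    (hT.models_extAxiom n k).realize_sentence M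

theorem IsModelCompletion.isSatisfiable : T.IsSatisfiable := by
  have : Nonempty (Coord ℕ) := ⟨fun _ => 0⟩
  obtain ⟨N, _, hN, ⟨g⟩⟩ := hT.consistent _ (model_nestedTheory_iff.2
    (Coord.isNested (K := ℕ)))
  have : Nonempty N := .map g inferInstance
  exact Theory.Model.isSatisfiable N

theorem IsModelCompletion.isComplete : T.IsComplete := by
  refine ⟨hT.isSatisfiable, fun φ => ?_⟩
  obtain ⟨N⟩ := hT.isSatisfiable
  have key : ∀ M : T.ModelType, M ⊨ φ ↔ N ⊨ φ := fun M =>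
    Agree.realize_iff (hT.isNested M.is_model) (hT.hasExtension M.is_model)
      (hT.isNested N.is_model) (hT.hasExtension N.is_model) (fun i => i.elim) φ
  by_cases h : N ⊨ φ
  · exact Or.inl (Theory.models_sentence_iff.2 fun M => (key M).2 h)
  · refine Or.inr (Theory.models_sentence_iff.2 fun M => ?_)
    exact (Formula.realize_not).2 fun h' => h ((key M).1 h')

end ModelCompletion

/-! ### Stability -/

section Stability

/-- Codes for the atomic type of an element over `A`: an element of `A` equal to it if there is one,
and, if it is related to some element of `A` at some level `l`, representatives in `A` for its
classes up to level `l`. -/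
abbrev TypeCode (A : Type*) : Type _ :=
  Option A × Option (Σ l : ℕ, ({s : Idx // s.n ≤ l} → Option A))

/-- This makes `TypeCode` countable over a countable set, and later bounds antichains of indices. -/
instance (l : ℕ) : Finite {s : Idx // s.n ≤ l} := by
  refine Finite.of_injective (β := Fin (l + 1) × Fin (l + 1))
    (fun s => (⟨s.1.m, by have := s.1.lt; have := s.2; omega⟩, ⟨s.1.n, Nat.lt_succ_of_le s.2⟩)) ?_
  rintro ⟨⟨m, n, h⟩, hs⟩ ⟨⟨m', n', h'⟩, hs'⟩ heq
  simp only [Prod.mk.injEq, Fin.mk.injEq] at heq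
  obtain ⟨rfl, rfl⟩ := heq
  rfl

variable {A : Type*} {N : Type*} [nestedLang.Structure N]

/-- The code `κ` describes the atomic type of `x` over the elements `e a`. -/
structure IsCoded (e : A → N) (x : N) (κ : TypeCode A) : Prop where
  eq_some : ∀ a, κ.1 = some a → x = e a
  eq_none : κ.1 = none → ∀ a, x ≠ e a
  rel_none : κ.2 = none → ∀ s a, ¬ E s x (e a)
  rel_some : ∀ l f, κ.2 = some ⟨l, f⟩ → ∃ s, f s ≠ none ∧ s.1.n = l
  rel_some_some : ∀ l f, κ.2 = some ⟨l, f⟩ → ∀ s a, f s = some a → E s.1 x (e a)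
  rel_some_none : ∀ l f, κ.2 = some ⟨l, f⟩ → ∀ s, f s = none → ∀ a, ¬ E s.1 x (e a)

/-- Once `x` is related to a parameter at some level, that parameter determines all higher classes,
so finitely many classes need recording. -/
theorem exists_isCoded (e : A → N) (x : N) : ∃ κ, IsCoded e x κ := by
  classical
  obtain ⟨o, ho, ho'⟩ : ∃ o : Option A, (∀ a, o = some a → x = e a) ∧
      (o = none → ∀ a, x ≠ e a) := by
    by_cases h : ∃ a, x = e a
    · obtain ⟨a, ha⟩ := h
      exact ⟨some a, by simpa using ha, by simp⟩
    · exact ⟨none, by simp, fun _ => not_exists.1 h⟩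
  by_cases h : ∃ s a, E s x (e a)
  · obtain ⟨s, a, hs⟩ := h
    have key : ∀ t : Idx, ∃ o : Option A, (∀ b, o = some b → E t x (e b)) ∧
        (o = none → ∀ b, ¬ E t x (e b)) := by
      intro t
      by_cases h : ∃ b, E t x (e b)
      · obtain ⟨b, hb⟩ := h
        exact ⟨some b, by simpa using hb, by simp⟩
      · exact ⟨none, by simp, fun _ => not_exists.1 h⟩
    choose f hf hf' using key
    refine ⟨⟨o, some ⟨s.n, fun t => f t⟩⟩, ho, ho', by simp, ?_, ?_, ?_⟩
    · rintro l g ⟨⟩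
      exact ⟨⟨s, le_rfl⟩, fun h => hf' s h a hs, rfl⟩
    · rintro l g ⟨⟩ t b hb
      exact hf t b hb
    · rintro l g ⟨⟩ t ht
      exact hf' t ht
  · push Not at h
    exact ⟨⟨o, none⟩, ho, ho', fun _ => h, by simp, by simp, by simp⟩

variable {N₁ N₂ : Type*} [nestedLang.Structure N₁] [nestedLang.Structure N₂]

theorem IsCoded.imp (h₁ : IsNested N₁) (h₂ : IsNested N₂) {e₁ : A → N₁} {e₂ : A → N₂}
    (he : Agree e₁ e₂) {x₁ : N₁} {x₂ : N₂} {κ : TypeCode A} (hx₁ : IsCoded e₁ x₁ κ)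
    (hx₂ : IsCoded e₂ x₂ κ) (a : A) :
    (x₁ = e₁ a → x₂ = e₂ a) ∧ ∀ s, E s x₁ (e₁ a) → E s x₂ (e₂ a) := by
  constructor
  · intro h
    rcases ho : κ.1 with - | b
    · exact absurd h (hx₁.eq_none ho a)
    · rw [hx₁.eq_some b ho] at h
      rw [hx₂.eq_some b ho]
      exact (he _ _).1.1 h
  · intro s h
    have of_common : ∀ b, E s x₁ (e₁ b) → E s x₂ (e₂ b) → E s x₂ (e₂ a) := fun b hb₁ hb₂ =>
      h₂.trans _ _ _ _ hb₂ (((he b a).2 s).1 ((h₁.congr_left hb₁).1 h))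
    rcases hκ : κ.2 with - | ⟨l, f⟩
    · exact absurd h (hx₁.rel_none hκ s a)
    by_cases hs : s.n ≤ l
    · rcases hf : f ⟨s, hs⟩ with - | b
      · exact absurd h (hx₁.rel_some_none l f hκ _ hf a)
      · exact of_common b (hx₁.rel_some_some l f hκ _ b hf) (hx₂.rel_some_some l f hκ _ b hf)
    · obtain ⟨t, ht, htl⟩ := hx₁.rel_some l f hκ
      obtain ⟨b, hb⟩ := Option.ne_none_iff_exists'.1 ht
      have hts : t.1 ≤ s := Or.inr (by omega)
      exact of_common b (h₁.mono _ _ _ _ hts (hx₁.rel_some_some l f hκ _ b hb))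
        (h₂.mono _ _ _ _ hts (hx₂.rel_some_some l f hκ _ b hb))

theorem Agree.symm {ι : Type*} {u : ι → N₁} {w : ι → N₂} (h : Agree u w) : Agree w u :=
  fun i j => ⟨(h i j).1.symm, fun s => ((h i j).2 s).symm⟩

theorem Agree.trans {ι : Type*} {u : ι → N} {v : ι → N₁} {w : ι → N₂} (h : Agree u v)
    (h' : Agree v w) : Agree u w :=
  fun i j => ⟨(h i j).1.trans (h' i j).1, fun s => ((h i j).2 s).trans ((h' i j).2 s)⟩

theorem IsCoded.iff (h₁ : IsNested N₁) (h₂ : IsNested N₂) {e₁ : A → N₁} {e₂ : A → N₂}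
    (he : Agree e₁ e₂) {x₁ : N₁} {x₂ : N₂} {κ : TypeCode A} (hx₁ : IsCoded e₁ x₁ κ)
    (hx₂ : IsCoded e₂ x₂ κ) (a : A) :
    (x₁ = e₁ a ↔ x₂ = e₂ a) ∧ ∀ s, E s x₁ (e₁ a) ↔ E s x₂ (e₂ a) :=
  ⟨⟨(hx₁.imp h₁ h₂ he hx₂ a).1, (hx₂.imp h₂ h₁ he.symm hx₁ a).1⟩,
    fun s => ⟨(hx₁.imp h₁ h₂ he hx₂ a).2 s, (hx₂.imp h₂ h₁ he.symm hx₁ a).2 s⟩⟩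

theorem agree_sumElim_of_isCoded (h₁ : IsNested N₁) (h₂ : IsNested N₂) {e₁ : A → N₁}
    {e₂ : A → N₂} (he : Agree e₁ e₂) {ι : Type*} {v₁ : ι → N₁} {v₂ : ι → N₂}
    {κ : ι → TypeCode A} {μ : ι → ι → TypeCode Unit}
    (hκ₁ : ∀ i, IsCoded e₁ (v₁ i) (κ i)) (hκ₂ : ∀ i, IsCoded e₂ (v₂ i) (κ i))
    (hμ₁ : ∀ i j, IsCoded (fun _ => v₁ j) (v₁ i) (μ i j))
    (hμ₂ : ∀ i j, IsCoded (fun _ => v₂ j) (v₂ i) (μ i j)) :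
    Agree (Sum.elim e₁ v₁) (Sum.elim e₂ v₂) := by
  have unit : ∀ j, Agree (fun _ : Unit => v₁ j) (fun _ : Unit => v₂ j) := fun j _ _ =>
    ⟨iff_of_true rfl rfl, fun s => iff_of_true (h₁.refl _ _) (h₂.refl _ _)⟩
  rintro (a | i) (b | j)
  · exact he a b
  · obtain ⟨h, h'⟩ := (hκ₁ j).iff h₁ h₂ he (hκ₂ j) a
    exact ⟨eq_comm.trans (h.trans eq_comm), fun s => h₁.comm.trans ((h' s).trans h₂.comm)⟩
  · exact (hκ₁ i).iff h₁ h₂ he (hκ₂ i) b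
  · exact (hμ₁ i j).iff h₁ h₂ (unit j) (hμ₂ i j) ()

variable {T : nestedLang.Theory}

/-- Trades the constants of the expanded language for a map `e`, so that quantifier elimination in
`nestedLang` applies to types over `A`. -/
theorem exists_realization_over {M : Type u} [nestedLang.Structure M] [Nonempty M]
    (hM : M ⊨ T) {A : Set M} {n : ℕ}
    (p : (nestedLang[[A]].completeTheory M).CompleteType (Fin n)) :
    ∃ (N : Type u) (_ : nestedLang.Structure N) (e : A → N) (v : Fin n → N),
      Nonempty N ∧ N ⊨ T ∧ Agree (fun a : A => (a : M)) e ∧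
      ∀ ψ : nestedLang[[A]].Formula (Fin n), Formula.equivSentence ψ ∈ p ↔
        (BoundedFormula.constantsVarsEquiv ψ).Realize (Sum.elim e v) default := by
  obtain ⟨N, v, hv⟩ := Theory.exists_modelType_is_realized_in _ p
  let _ : nestedLang.Structure N := (nestedLang.lhomWithConstants A).reduct N
  have : (nestedLang.lhomWithConstants A).IsExpansionOn N := LHom.isExpansionOn_reduct _ _
  have hN : ∀ φ : nestedLang[[A]].Sentence, N ⊨ φ ↔ M ⊨ φ := by
    intro φ
    have h : ∀ φ : nestedLang[[A]].Sentence, M ⊨ φ → N ⊨ φ := fun φ hφ =>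
      N.is_model.realize_of_mem φ hφ
    refine ⟨fun hφ => ?_, h φ⟩
    by_contra hφ'
    exact Formula.realize_not.1 (h (Formula.not φ) (Formula.realize_not.2 hφ')) hφ
  refine ⟨N, inferInstance, fun a => (nestedLang.con a : N), v, N.nonempty', ?_, ?_, ?_⟩
  · refine ⟨fun φ hφ => ?_⟩
    have := (hN ((nestedLang.lhomWithConstants A).onSentence φ)).2
      ((LHom.realize_onSentence M _ φ).2 (hM.realize_of_mem φ hφ))
    exact (LHom.realize_onSentence N _ φ).1 this
  · refine agree_of_realize_iff fun φ => ?_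
    have h := hN (Formula.equivSentence φ)
    rw [Formula.realize_equivSentence, Formula.realize_equivSentence] at h
    exact h.symm
  · intro ψ
    rw [← hv, Theory.CompleteType.formula_mem_typeOf]
    exact BoundedFormula.realize_constantsVarsEquiv.symm

theorem IsModelCompletion.isAleph0Stable (hT : IsModelCompletion nestedTheory T) :
    IsAleph0Stable.{0, 0, u} T := by
  intro M _ _ hM A hA n
  have : Countable A := hA
  choose N sN e v hne hmod hag hmem using
    fun p : (nestedLang[[A]].completeTheory M).CompleteType (Fin n) =>
      exists_realization_over hM p
  have hc : ∀ p, ∃ c : (Fin n → TypeCode A) × (Fin n → Fin n → TypeCode Unit),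
      (∀ i, IsCoded (e p) (v p i) (c.1 i)) ∧
      ∀ i j, IsCoded (fun _ => v p j) (v p i) (c.2 i j) := by
    intro p
    choose κ hκ using fun i => exists_isCoded (e p) (v p i)
    choose μ hμ using fun i j => exists_isCoded (fun _ : Unit => v p j) (v p i)
    exact ⟨(κ, μ), hκ, hμ⟩
  choose c hc₁ hc₂ using hc
  refine Function.Injective.countable (f := c) fun p q hpq => ?_
  have hp := hT.isNested (hmod p)
  have hq := hT.isNested (hmod q)
  have hagree := agree_sumElim_of_isCoded hp hq ((hag p).symm.trans (hag q)) (hc₁ p)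
    (hpq ▸ hc₁ q) (hc₂ p) (hpq ▸ hc₂ q)
  refine SetLike.ext fun φ => ?_
  obtain ⟨ψ, rfl⟩ := Formula.equivSentence.surjective φ
  rw [hmem, hmem]
  exact hagree.realize_iff hp (hT.hasExtension (hmod p)) hq (hT.hasExtension (hmod q)) _

end Stability

/-! ### Mutually indiscernible sequences -/

section Indiscernible

variable {M : Type*} [nestedLang.Structure M]

theorem indiscernibleOver_of_agree [Nonempty M] (hM : IsNested M) (hext : HasExtension M)
    {B : Set M} {I : Type*} [LinearOrder I] {α : Type*} {a : I → α → M}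
    (h : ∀ (n : ℕ) (s t : Fin n ↪o I),
      Agree (Sum.elim (fun b : B => (b : M)) fun x : Fin n × α => a (s x.1) x.2)
        (Sum.elim (fun b : B => (b : M)) fun x : Fin n × α => a (t x.1) x.2)) :
    IndiscernibleOver nestedLang B a :=
  fun n s t φ => (h n s t).realize_iff hM hext hM hext φ

theorem agree_of_indiscernibleOver {B : Set M} {I : Type*} [LinearOrder I] {α : Type*}
    {a : I → α → M} (h : IndiscernibleOver nestedLang B a) (n : ℕ) (s t : Fin n ↪o I) :
    Agree (Sum.elim (fun b : B => (b : M)) fun x : Fin n × α => a (s x.1) x.2)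
      (Sum.elim (fun b : B => (b : M)) fun x : Fin n × α => a (t x.1) x.2) :=
  agree_of_realize_iff (h n s t)

theorem iff_of_indiscernibleOver {B : Set M} {I : Type*} [LinearOrder I] {α : Type*}
    {a : I → α → M} (h : IndiscernibleOver nestedLang B a) {b : M} (hb : b ∈ B) (i i' : I)
    (x : α) : (b = a i x ↔ b = a i' x) ∧ ∀ s, E s b (a i x) ↔ E s b (a i' x) :=
  agree_of_indiscernibleOver h 1 (OrderEmbedding.ofStrictMono (fun _ => i) (Subsingleton.strictMono _))
    (OrderEmbedding.ofStrictMono (fun _ => i') (Subsingleton.strictMono _))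
    (Sum.inl ⟨b, hb⟩) (Sum.inr (0, x))

/-- Atomic formulas involve at most two elements, and pairs of entries already agree by
indiscernibility over `B`; only a pair of `c` and one entry can fail. -/
theorem exists_distinguished_of_not_indiscernibleOver [Nonempty M] (hM : IsNested M)
    (hext : HasExtension M) {B : Set M} {I : Type*} [LinearOrder I] {α : Type*} {a : I → α → M}
    {c : M} (h : IndiscernibleOver nestedLang B a) (hc : ¬ IndiscernibleOver nestedLang {c} a) :
    ∃ i i' x, (c = a i x ∧ c ≠ a i' x) ∨ ∃ s, E s c (a i x) ∧ ¬ E s c (a i' x) := by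
  by_contra! hne
  have key : ∀ i i' x, (c = a i x ↔ c = a i' x) ∧ ∀ s, E s c (a i x) ↔ E s c (a i' x) :=
    fun i i' x => ⟨⟨(hne i i' x).1, (hne i' i x).1⟩,
      fun s => ⟨(hne i i' x).2 s, (hne i' i x).2 s⟩⟩
  refine hc (indiscernibleOver_of_agree hM hext fun n s t => ?_)
  have hst := agree_of_indiscernibleOver h n s t
  rintro (⟨_, rfl⟩ | p) (⟨_, rfl⟩ | q)
  · exact ⟨Iff.rfl, fun _ => Iff.rfl⟩
  · exact key _ _ _
  · obtain ⟨h₁, h₂⟩ := key (s p.1) (t p.1) p.2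
    exact ⟨eq_comm.trans (h₁.trans eq_comm), fun r => hM.comm.trans ((h₂ r).trans hM.comm)⟩
  · exact hst (Sum.inr p) (Sum.inr q)

/-- No infinite family of mutually indiscernible sequences is such that none of its members is
indiscernible over a given element. -/
theorem exists_indiscernibleOver_singleton [Nonempty M] (hM : IsNested M) (hext : HasExtension M)
    (c : M) {J : Type*} [Infinite J] {I : J → Type*} [∀ j, LinearOrder (I j)] {α : J → Type*}
    {a : ∀ j, I j → α j → M} (h : MutuallyIndiscernibleOver nestedLang ∅ a) :
    ∃ j, IndiscernibleOver nestedLang {c} (a j) := by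
  by_contra! hc
  have hmem : ∀ {j k : J}, j ≠ k → ∀ i x,
      a j i x ∈ (∅ ∪ {m | ∃ l, l ≠ k ∧ ∃ i x, a l i x = m} : Set M) :=
    fun hjk i x => Or.inr ⟨_, hjk, i, x, rfl⟩
  choose i i' x hx using fun j =>
    exists_distinguished_of_not_indiscernibleOver hM hext (h j) (hc j)
  -- An entry of one sequence is a parameter for every other sequence, so it cannot distinguish
  -- entries there as `c` does.
  have hne : ∀ j i y, c ≠ a j i y := by
    rintro j i₀ y hj
    obtain ⟨k, hk⟩ := exists_ne j
    have := iff_of_indiscernibleOver (h k) (hmem hk.symm i₀ y) (i k) (i' k) (x k)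
    rw [← hj] at this
    rcases hx k with ⟨h₁, h₂⟩ | ⟨s, h₁, h₂⟩
    · exact h₂ (this.1.1 h₁)
    · exact h₂ ((this.2 s).1 h₁)
  have hrel : ∀ j, ∃ s, E s c (a j (i j) (x j)) ∧ ¬ E s c (a j (i' j) (x j)) := fun j =>
    (hx j).resolve_left fun h => hne _ _ _ h.1
  choose s hs hs' using hrel
  -- If `s j ≤ s k`, the entry of sequence `j` related to `c` lies in the `s k`-class of `c`, and as
  -- a parameter it would separate entries of sequence `k`.
  have hle : ∀ {j k}, j ≠ k → ¬ s j ≤ s k := by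
    intro j k hjk hjk'
    have hcb : E (s k) c (a j (i j) (x j)) := hM.mono _ _ _ _ hjk' (hs j)
    have := (iff_of_indiscernibleOver (h k) (hmem hjk (i j) (x j)) (i k) (i' k) (x k)).2 (s k)
    rw [← hM.congr_left hcb, ← hM.congr_left hcb] at this
    exact hs' k (this.1 (hs k))
  have hlevel : ∀ j k, (s j).n ≤ (s k).n := by
    intro j k
    by_contra! hlt
    exact hle (fun h => by subst h; exact lt_irrefl _ hlt) (Or.inr hlt : s k ≤ s j)
  obtain ⟨j₀⟩ : Nonempty J := inferInstance
  refine not_injective_infinite_finite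
    (fun j => (⟨s j, hlevel j j₀⟩ : {t : Idx // t.n ≤ (s j₀).n})) fun j k hjk => ?_
  by_contra hne
  exact hle hne (Subtype.ext_iff.1 hjk).le

theorem exists_generic_points [Nonempty M] (hM : IsNested M) (hext : HasExtension M) (c : M)
    (n : ℕ) (X : Type*) [Encodable X] :
    ∃ d : Option X → M, d none = c ∧
      ∀ p q, p ≠ q → ∀ s, E s (d p) (d q) ↔ n + 1 ≤ s.n := by
  obtain ⟨f, hf, hf'⟩ := exists_seq_of_forall_finset_exists
    (fun x : M => ∀ s : Idx, E s x c ↔ n + 1 ≤ s.n)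
    (fun x y => ∀ s : Idx, s.n ≤ n → ¬ E s y x) (fun S _ => by
      obtain ⟨y, hy, hy'⟩ := hext.exists_of_finite n (fun _ => c)
        (fun o : Option S => o.elim c Subtype.val) fun _ _ => hM.relFrom_refl _ _
      refine ⟨y, fun s => ⟨fun h => ?_, fun h => hM.relFrom_of_forall (fun m hm => hy ⟨m, hm⟩) s h⟩,
        fun x hx s hs => (hy' (some ⟨x, hx⟩)).2 s hs⟩
      by_contra! hs
      exact (hy' none).2 s (Nat.lt_succ_iff.1 hs) h)
  have hff : ∀ p q, p ≠ q → ∀ s, E s (f p) (f q) ↔ n + 1 ≤ s.n := by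
    intro p q hpq s
    refine ⟨fun h => ?_, fun h => hM.trans _ _ _ _ ((hf p s).2 h) (hM.symm _ _ _ ((hf q s).2 h))⟩
    by_contra! hs
    rcases hpq.lt_or_gt with hlt | hlt
    · exact hf' p q hlt s (Nat.lt_succ_iff.1 hs) (hM.symm _ _ _ h)
    · exact hf' q p hlt s (Nat.lt_succ_iff.1 hs) h
  refine ⟨fun o => o.elim c fun x => f (Encodable.encode x), rfl, ?_⟩
  rintro (_ | p) (_ | q) hpq s
  · exact absurd rfl hpq
  · exact hM.comm.trans (hf _ s)
  · exact hf _ s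
  · exact hff _ _ (fun h => hpq (congrArg some (Encodable.encode_injective h))) s

theorem exists_generic_array [Nonempty M] (hM : IsNested M) (hext : HasExtension M) (c : M)
    (n : ℕ) :
    ∃ d : Fin n × ℕ → M, (∀ p q, p ≠ q → d p ≠ d q ∧ ∀ s, E s (d p) (d q) ↔ n + 1 ≤ s.n) ∧
      ∀ j : Fin n, E ⟨j, n, j.2⟩ c (d (j, 0)) ∧ ¬ E ⟨j, n, j.2⟩ c (d (j, 1)) := by
  rcases n with - | k
  · exact ⟨fun p => p.1.elim0, fun p => p.1.elim0, fun j => j.elim0⟩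
  obtain ⟨e, he, he'⟩ := exists_generic_points hM hext c (k + 1)
    ((Fin (k + 1) × Fin (k + 1)) ⊕ (Fin (k + 1) × ℕ))
  -- `label p m` names the class of level `k + 1` that `d p` occupies for relation `m`. It is the
  -- class of `c` exactly for `p = (m, 0)`; for fixed `m`, distinct `p` get distinct classes.
  let label : Fin (k + 1) × ℕ → Fin (k + 1) →
      Option ((Fin (k + 1) × Fin (k + 1)) ⊕ (Fin (k + 1) × ℕ)) := fun p m =>
    if p.2 = 0 then (if m = p.1 then none else some (Sum.inl (p.1, m))) else some (Sum.inr p)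
  have hlabel : ∀ p q m, p ≠ q → label p m ≠ label q m := by
    rintro ⟨j, i⟩ ⟨j', i'⟩ m hpq
    simp only [label]
    split_ifs <;> simp_all
  have hee : ∀ p q, RelFrom (k + 2) (e p) (e q) := by
    intro p q
    by_cases hpq : p = q
    · exact hpq ▸ hM.relFrom_refl _ _
    · exact fun s hs => (he' p q hpq s).2 hs
  have hd : ∀ p, ∃ x, ∀ m : Fin (k + 1), E ⟨m, k + 1, m.2⟩ x (e (label p m)) := fun p => by
    obtain ⟨x, hx, -⟩ := hext k 0 (fun m => e (label p m)) Fin.elim0 fun _ _ => hee _ _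
    exact ⟨x, hx⟩
  choose d hd using hd
  have hdd : ∀ p q, p ≠ q → ∀ s, E s (d p) (d q) ↔ k + 1 + 1 ≤ s.n := by
    intro p q hpq s
    constructor
    · intro h
      by_contra! hs
      obtain ⟨m, hm⟩ : ∃ m : Fin (k + 1), E ⟨m, k + 1, m.2⟩ (d p) (d q) := by
        rcases (Nat.lt_succ_iff.1 hs).eq_or_lt with hs | hs
        · obtain ⟨m, n, hmn⟩ := s
          obtain rfl : n = k + 1 := hs
          exact ⟨⟨m, hmn⟩, h⟩
        · exact ⟨0, hM.mono _ _ _ _ (Or.inr hs) h⟩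
      rw [hM.congr_left (hd p m), hM.congr_right (hd q m), he' _ _ (hlabel p q m hpq)] at hm
      exact absurd hm (Nat.not_succ_le_self _)
    · intro hs
      exact hM.relFrom_trans (hM.relFrom_of_rel (hd p 0)) (hM.relFrom_trans (hee _ _)
        (hM.relFrom_symm (hM.relFrom_of_rel (hd q 0)))) s hs
  refine ⟨d, fun p q hpq => ⟨fun h => ?_, hdd p q hpq⟩, fun j => ⟨?_, fun h => ?_⟩⟩
  · have := (hdd p q hpq ⟨0, k + 1, k.succ_pos⟩).1 (h ▸ hM.refl _ _)
    exact absurd this (Nat.not_succ_le_self _)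
  · have := hd (j, 0) j
    simp only [label, if_true, he] at this
    exact hM.symm _ _ _ this
  · rw [hM.congr_right (hd (j, 1) j), ← he, he' _ _ (by simp [label])] at h
    exact absurd h (Nat.not_succ_le_self _)

/-- Over every element there are finite families of every size of mutually indiscernible
sequences none of which is indiscernible over the element. -/
theorem exists_mutuallyIndiscernible [Nonempty M] (hM : IsNested M) (hext : HasExtension M) (c : M)
    {n : ℕ} {J I α : Type*} [LinearOrder I] [Nonempty α] (e : J ≃ Fin n) (f : I ≃ ℕ) :
    ∃ a : J → I → α → M, MutuallyIndiscernibleOver nestedLang ∅ a ∧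
      ∀ j, ¬ IndiscernibleOver nestedLang {c} (a j) := by
  obtain ⟨d, hd, hdc⟩ := exists_generic_array hM hext c n
  refine ⟨fun j i _ => d (e j, f i), fun j => ?_, fun j h => ?_⟩
  · refine indiscernibleOver_of_agree hM hext fun m s t => ?_
    have inl_inr : ∀ b ∈ (∅ ∪ {m | ∃ k, k ≠ j ∧ ∃ (i : I) (_ : α), d (e k, f i) = m} : Set M),
        ∀ i i', (b = d (e j, f i) ↔ b = d (e j, f i')) ∧
          ∀ r, E r b (d (e j, f i)) ↔ E r b (d (e j, f i')) := by
      rintro b (hb | ⟨k, hk, l, -, rfl⟩) i i'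
      · exact hb.elim
      · have hne : ∀ i, (e k, f l) ≠ (e j, f i) := fun i h =>
          hk (e.injective (congrArg Prod.fst h))
        exact ⟨iff_of_false (hd _ _ (hne i)).1 (hd _ _ (hne i')).1,
          fun r => ((hd _ _ (hne i)).2 r).trans ((hd _ _ (hne i')).2 r).symm⟩
    rintro (b | p) (b' | q)
    · exact ⟨Iff.rfl, fun _ => Iff.rfl⟩
    · exact inl_inr b b.2 _ _
    · obtain ⟨h₁, h₂⟩ := inl_inr b' b'.2 (s p.1) (t p.1)
      exact ⟨eq_comm.trans (h₁.trans eq_comm), fun r => hM.comm.trans ((h₂ r).trans hM.comm)⟩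
    · simp only [Sum.elim_inr]
      by_cases hpq : p.1 = q.1
      · rw [hpq]
        exact ⟨iff_of_true rfl rfl, fun r => iff_of_true (hM.refl _ _) (hM.refl _ _)⟩
      · have hne : ∀ s : Fin m ↪o I, (e j, f (s p.1)) ≠ (e j, f (s q.1)) := fun s h =>
          hpq (s.injective (f.injective (congrArg Prod.snd h)))
        exact ⟨iff_of_false (hd _ _ (hne s)).1 (hd _ _ (hne t)).1,
          fun r => ((hd _ _ (hne s)).2 r).trans ((hd _ _ (hne t)).2 r).symm⟩
  · obtain ⟨y⟩ := ‹Nonempty α›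
    have := (iff_of_indiscernibleOver h (Set.mem_singleton c) (f.symm 0) (f.symm 1) y).2
      ⟨e j, n, (e j).2⟩
    simp only [Equiv.apply_symm_apply] at this
    exact (hdc (e j)).2 (this.1 (hdc (e j)).1)

end Indiscernible

/-! ### The dp-rank of the unique 1-type -/

section Rank

variable {T : nestedLang.Theory} (hT : IsModelCompletion nestedTheory T)
include hT

theorem IsModelCompletion.oneType_eq (p q : T.CompleteType (Fin 1)) : p = q := by
  obtain ⟨M, v, rfl⟩ := Theory.exists_modelType_is_realized_in _ p
  obtain ⟨N, w, rfl⟩ := Theory.exists_modelType_is_realized_in _ q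
  have hM := hT.isNested M.is_model
  have hN := hT.isNested N.is_model
  refine SetLike.ext fun φ => ?_
  obtain ⟨ψ, rfl⟩ := Formula.equivSentence.surjective φ
  rw [Theory.CompleteType.formula_mem_typeOf, Theory.CompleteType.formula_mem_typeOf]
  refine Agree.realize_iff hM (hT.hasExtension M.is_model) hN (hT.hasExtension N.is_model)
    (fun i j => ?_) ψ
  obtain rfl := Subsingleton.elim i j
  exact ⟨iff_of_true rfl rfl, fun s => iff_of_true (hM.refl _ _) (hN.refl _ _)⟩

theorem IsModelCompletion.hasDpRank_aleph0 (p : T.CompleteType (Fin 1)) :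
    HasDpRank.{0, 0, w} p ℵ₀ := by
  constructor
  · intro M _ _ hM c _ J I _ _ α a hJ ha
    have : Infinite J := Cardinal.infinite_iff.2 (hJ ▸ self_le_add_left _ _)
    rw [Set.range_unique]
    exact exists_indiscernibleOver_singleton (hT.isNested hM) (hT.hasExtension hM) _ ha
  · intro ν hν h
    obtain ⟨n, rfl⟩ := Cardinal.lt_aleph0.1 hν
    obtain ⟨N⟩ := hT.isSatisfiable
    let M : T.ModelType := Theory.ModelType.ulift.{0, 0, 0, w} N
    obtain ⟨c⟩ := M.nonempty'
    obtain ⟨a, ha, ha'⟩ := exists_mutuallyIndiscernible (hT.isNested M.is_model)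
      (hT.hasExtension M.is_model) c (n := 1 + n) (J := ULift.{w} (Fin (1 + n)))
      (I := ULift.{w} ℕ) (α := PUnit.{w + 1}) Equiv.ulift Equiv.ulift
    obtain ⟨j, hj⟩ := h M (fun _ => c) (hT.oneType_eq _ _) _ _ _ a (by simp) ha
    rw [Set.range_const] at hj
    exact ha' j hj

end Rank

end DpRank

theorem mainTheorem10 :
    (∃ T : DpRank.nestedLang.Theory, DpRank.IsModelCompletion DpRank.nestedTheory T) ∧
    ∀ T : DpRank.nestedLang.Theory, DpRank.IsModelCompletion DpRank.nestedTheory T →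
      T.IsComplete ∧
      DpRank.IsAleph0Stable.{0, 0, u} T ∧
      -- finite families of every size, over every element of every model
      (∀ (M : Type u) [DpRank.nestedLang.Structure M], M ⊨ T → ∀ (c : M) (n : ℕ),
        ∃ a : Fin n → ℕ → Fin 1 → M,
          DpRank.MutuallyIndiscernibleOver DpRank.nestedLang ∅ a ∧
          ∀ j, ¬ DpRank.IndiscernibleOver DpRank.nestedLang {c} (a j)) ∧
      -- no infinite family
      (∀ (M : Type u) [DpRank.nestedLang.Structure M], M ⊨ T → ∀ (c : M)
        (J : Type v) [Infinite J] (I : J → Type v) [∀ j, LinearOrder (I j)]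
        [∀ j, Infinite (I j)] (α : J → Type v) (a : ∀ j, I j → α j → M),
        ¬ (DpRank.MutuallyIndiscernibleOver DpRank.nestedLang ∅ a ∧
          ∀ j, ¬ DpRank.IndiscernibleOver DpRank.nestedLang {c} (a j))) ∧
      -- the unique complete `1`-type over the empty set has dp-rank `ℵ₀`
      ∃ p : T.CompleteType (Fin 1), (∀ q : T.CompleteType (Fin 1), q = p) ∧
        DpRank.HasDpRank.{0, 0, w} p ℵ₀ := by
  refine ⟨⟨_, DpRank.isModelCompletion_genericTheory⟩, fun T hT => ?_⟩
  refine ⟨hT.isComplete, hT.isAleph0Stable, fun M _ hM c n => ?_,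
    fun M _ hM c J _ I _ _ α a h => ?_, ?_⟩
  · have : Nonempty M := ⟨c⟩
    exact DpRank.exists_mutuallyIndiscernible (hT.isNested hM) (hT.hasExtension hM) c
      (Equiv.refl _) (Equiv.refl _)
  · have : Nonempty M := ⟨c⟩
    obtain ⟨j, hj⟩ := DpRank.exists_indiscernibleOver_singleton (hT.isNested hM)
      (hT.hasExtension hM) c h.1
    exact h.2 j hj
  · obtain ⟨p⟩ := Theory.CompleteType.nonempty_iff (α := Fin 1).2 hT.isSatisfiable
    exact ⟨p, fun q => hT.oneType_eq q p, hT.hasDpRank_aleph0 p⟩
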